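/- Theorem [CH]. Let $K$ and $S$ be compact Hausdorff spaces, with $K$ nonmetrizable and $S$ infinite, whose $\omega$-derived sets are empty: $\bigcap_{n} K^{(n)}=\emptyset$ and $\bigcap_{n} S^{(n)}=\emptyset$, where $K^{(0)}=K$ and $K^{(n+1)}$ is the set of accumulation points of $K^{(n)}$, and likewise for $S$. Assume the Continuum Hypothesis $\aleph_1=2^{\aleph_0}$. Then $\mathrm{Ext}(C(K),C(S))\neq 0$; that is, there are a Banach space $E$ and a short exact sequence $0\to C(S)\to E\to C(K)\to 0$ of Banach spaces and bounded linear operators which does not split, in the sense that the image of $C(S)$ is not complemented in $E$. In particular, for every such $K$, $\mathrm{Ext}(C(K),c_0)\neq 0$: there is a short exact sequence $0\to c_0\to E\to C(K)\to 0$ of Banach spaces which does not split. (The scalars are either the real or the complex numbers, the same for all spaces.) -/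

import Mathlib

universe u v w

/-- `0 → Y → X → Z → 0`, with arrows `i` and `q`, is a short exact sequence of Banach spaces:
the kernel of each arrow is the image of the preceding one. -/
structure IsShortExact {𝕜 : Type*} [RCLike 𝕜] {Y X Z : Type*}
    [NormedAddCommGroup Y] [NormedSpace 𝕜 Y] [NormedAddCommGroup X] [NormedSpace 𝕜 X]
    [NormedAddCommGroup Z] [NormedSpace 𝕜 Z] (i : Y →L[𝕜] X) (q : X →L[𝕜] Z) : Prop where
  injective : Function.Injective i
  exact : Function.Exact i q
  surjective : Function.Surjective q

/-- `Ext(Z, Y) = 0`: every short exact sequence `0 → Y → X → Z → 0` of Banach spaces splits,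
i.e. the image of `Y` is complemented in `X` (it is the range of a continuous projection).
A middle space `X` is in bijection with `Y × Z`, so that there is no loss in letting it range
over the universe of `Y × Z`. -/
def ExtEqZero (𝕜 : Type w) [RCLike 𝕜] (Z : Type u) (Y : Type v)
    [NormedAddCommGroup Z] [NormedSpace 𝕜 Z] [NormedAddCommGroup Y] [NormedSpace 𝕜 Y] : Prop :=
  ∀ (X : Type (max u v)) [NormedAddCommGroup X] [NormedSpace 𝕜 X] [CompleteSpace X]
    (i : Y →L[𝕜] X) (q : X →L[𝕜] Z), IsShortExact i q →
      (LinearMap.range i.toLinearMap).ClosedComplemented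

/-- The `ω`-derived set `⋂ n, K⁽ⁿ⁾` of a space `K`, where `K⁽⁰⁾ = K` and `K⁽ⁿ⁺¹⁾` is the set of
accumulation points of `K⁽ⁿ⁾`. -/
def omegaDerivedSet (K : Type*) [TopologicalSpace K] : Set K :=
  ⋂ n : ℕ, derivedSet^[n] Set.univ

/-!
Write `K⁽ⁿ⁾` for the iterated derived sets of `K`; by compactness some `K⁽ⁿ⁾` is empty.

A countable compact Hausdorff space is metrizable, so `K` is uncountable and there is a last
uncountable `L = K⁽ᵏ⁾`. Since the derived set of `L` is countable, uncountably many isolated points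
of `L` converge to a single point `x` (`exists_uncountable_converging`). By the continuum
hypothesis they include a family `a γ` indexed by the Cantor set; take peak functions
`f γ ∈ C(K)` with `f γ (a γ) = 1` which vanish on the rest of `L`.

Let `A γ ⊆ ℕ` be the almost disjoint family of branches of the dyadic tree. Every set `σ` of
branches defines an operator `C(K) → ℓ_∞ / c₀`, mapping `f` to the sum over `γ ∈ σ` of the classes
of `(f (a γ) - f x) • 1_{A γ}`, and pulling back `0 → c₀ → ℓ_∞ → ℓ_∞ / c₀ → 0` along it gives a
twisted sum of `c₀` and `C(K)` (`isShortExact_twistedSum`). If `Ext(C(K), c₀) = 0`, this operator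
lifts to a sequence of functionals `μ σ n` on `C(K)` (`exists_isAlmostSum_of_extEqZero`), and
`μ σ n (f γ)` tends along `A γ` to `1` or `0` according to whether `γ ∈ σ`. Hence the matrix
`(n, γ) ↦ μ σ n (f γ)` determines `σ`.

There are too few such matrices. Functionals on `C(K)` are summable combinations of point
evaluations (`exists_hasSum_apply`), and up to values of the functions `f γ` there are only continuum
many points in `K` (`exists_cantor_representatives`). So the Cantor set would map onto its power set
(`not_extEqZero_zeroAtInfty`).

Finally an infinite `S` of finite height contains a nontrivial convergent sequence of isolated
points, which makes `c₀` a retract of `C(S)` (`exists_retraction_zeroAtInfty`), and the vanishing of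
`Ext(C(K), ·)` passes to retracts (`ExtEqZero.of_retract`).
-/

open Set Filter Topology

/-! ### Convergent families in compact spaces of finite height -/

section Topology

variable {K : Type*} [TopologicalSpace K]

lemma isClosed_iterate_derivedSet [T1Space K] (n : ℕ) : IsClosed (derivedSet^[n] (univ : Set K)) := by
  cases n with
  | zero => exact isClosed_univ
  | succ n => rw [Function.iterate_succ_apply']; exact isClosed_derivedSet _

lemma iterate_derivedSet_succ_subset [T1Space K] (n : ℕ) :
    derivedSet^[n + 1] (univ : Set K) ⊆ derivedSet^[n] univ := by
  rw [Function.iterate_succ_apply']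
  exact (isClosed_iff_derivedSet_subset _).1 (isClosed_iterate_derivedSet n)

lemma exists_iterate_derivedSet_eq_empty [CompactSpace K] [T2Space K]
    (hK : omegaDerivedSet K = ∅) : ∃ n, derivedSet^[n] (univ : Set K) = ∅ := by
  by_contra! h
  have := IsCompact.nonempty_iInter_of_sequence_nonempty_isCompact_isClosed
    (fun n => derivedSet^[n] (univ : Set K)) (fun n => iterate_derivedSet_succ_subset n) h
    (isClosed_iterate_derivedSet 0).isCompact isClosed_iterate_derivedSet
  rw [omegaDerivedSet] at hK
  exact this.ne_empty hK

lemma IsCompact.finite_of_disjoint_derivedSet {C A : Set K} (hC : IsCompact C) (hCA : C ⊆ A)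
    (h : Disjoint C (derivedSet A)) : C.Finite := by
  by_contra hinf
  obtain ⟨x, hx, hacc⟩ := Set.Infinite.exists_accPt_of_subset_isCompact hinf hC subset_rfl
  exact Set.disjoint_left.1 h hx (derivedSet_mono _ _ hCA hacc)

/-- If `x` is the only accumulation point of the closed set `L` lying in the closed set `V`, then
`V ∩ L` is a one-point compactification with point at infinity `x`. -/
lemma finite_inter_diff_of_inter_derivedSet_subset [CompactSpace K] {L V : Set K} {x : K}
    (hL : IsClosed L) (hV : IsClosed V) (h : V ∩ derivedSet L ⊆ {x}) {U : Set K} (hU : U ∈ 𝓝 x) :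
    ((V ∩ L) \ U).Finite := by
  have hfin : ((V ∩ L) \ interior U).Finite := by
    refine IsCompact.finite_of_disjoint_derivedSet (A := L) ?_ (fun z hz => hz.1.2) ?_
    · exact ((hV.inter hL).sdiff isOpen_interior).isCompact
    · refine Set.disjoint_left.2 fun z hz hz' => hz.2 ?_
      rw [show z = x from h ⟨hz.1.1, hz'⟩]
      exact mem_interior_iff_mem_nhds.2 hU
  exact hfin.subset (sdiff_subset_sdiff_right interior_subset)

lemma metrizableSpace_of_countable_of_compactSpace [CompactSpace K] [T2Space K] [Countable K] :
    TopologicalSpace.MetrizableSpace K := by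
  rcases isEmpty_or_nonempty {p : K × K // p.1 ≠ p.2} with hP | hP
  · have : Subsingleton K := ⟨fun x y => by
      by_contra hxy
      exact hP.false ⟨(x, y), hxy⟩⟩
    infer_instance
  · have hsep : ∀ p : {p : K × K // p.1 ≠ p.2}, ∃ f : C(K, ℝ), f p.1.1 ≠ f p.1.2 := by
      rintro ⟨⟨x, y⟩, hxy⟩
      obtain ⟨f, hf0, hf1, -⟩ := exists_continuous_zero_one_of_isClosed
        (isClosed_singleton (x := x)) (isClosed_singleton (x := y)) (by simpa using hxy)
      refine ⟨f, ?_⟩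
      simp [hf0 rfl, hf1 rfl]
    choose f hf using hsep
    obtain ⟨e, he⟩ := exists_surjective_nat {p : K × K // p.1 ≠ p.2}
    refine Metric.PiNatEmbed.TopologicalSpace.MetrizableSpace.of_countable_separating (fun n => f (e n))
      (fun n => (f (e n)).continuous) fun x y hxy => ?_
    obtain ⟨n, hn⟩ := he ⟨(x, y), hxy⟩
    exact ⟨n, by rw [hn]; exact hf _⟩

/-- A closed set which is uncountable but whose derived set is countable contains the one-point
compactification of an uncountable discrete set. Each point `x` of the derived set is cut out
there by a sequence of closed neighbourhoods in `K`; a finite family of these covering the derived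
set misses only finitely many points of `L`, and there are countably many such families. -/
lemma exists_uncountable_converging_of_countable_derivedSet [CompactSpace K] [T2Space K] {L : Set K}
    (hL : IsClosed L) (hLu : ¬ L.Countable) (hL' : (derivedSet L).Countable) :
    ∃ x ∈ derivedSet L, ∃ Γ ⊆ L \ derivedSet L, ¬ Γ.Countable ∧ ∀ U ∈ 𝓝 x, (Γ \ U).Finite := by
  -- `Z x` below is the intersection of the closed neighbourhoods of `x` that cut out `x`
  have hsep : ∀ x y : K, x ≠ y → ∃ V ∈ 𝓝 x, IsClosed V ∧ y ∉ V := fun x y hxy => by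
    obtain ⟨V, hV, hVc, hVs⟩ := exists_mem_nhds_isClosed_subset
      (isOpen_compl_singleton.mem_nhds (show x ∈ ({y}ᶜ : Set K) from hxy))
    exact ⟨V, hV, hVc, fun hy => hVs hy rfl⟩
  choose! V hVn hVc hVy using hsep
  let I : Type _ := {p : derivedSet L × derivedSet L // p.1 ≠ p.2}
  have : Countable (derivedSet L) := hL'
  let Z : K → Set K := fun x => ⋂ y ∈ derivedSet L \ {x}, V x y
  have hZc : ∀ x, IsClosed (Z x) := fun x =>
    isClosed_biInter fun y hy => hVc _ _ (Ne.symm hy.2)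
  have hZ' : ∀ x, Z x ∩ derivedSet L ⊆ {x} := by
    rintro x y ⟨hy, hyL⟩
    by_contra hyx
    exact hVy x y (Ne.symm hyx) (mem_iInter₂.1 hy y ⟨hyL, hyx⟩)
  suffices h : ∃ x ∈ derivedSet L, ¬ ((Z x ∩ L) \ derivedSet L).Countable by
    obtain ⟨x, hx, hu⟩ := h
    refine ⟨x, hx, (Z x ∩ L) \ derivedSet L, fun z hz => ⟨hz.1.2, hz.2⟩, hu, fun U hU => ?_⟩
    exact (finite_inter_diff_of_inter_derivedSet_subset hL (hZc x) (hZ' x) hU).subset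
      fun z hz => ⟨hz.1.1, hz.2⟩
  by_contra! hcon
  have hfin : ∀ F : Finset I, (derivedSet L ⊆ ⋃ i ∈ F, interior (V i.1.1 i.1.2)) →
      (L \ ⋃ i ∈ F, interior (V i.1.1 i.1.2)).Finite := by
    intro F hF
    refine IsCompact.finite_of_disjoint_derivedSet (A := L) ?_ sdiff_subset ?_
    · exact (hL.sdiff (isOpen_biUnion fun _ _ => isOpen_interior)).isCompact
    · exact Set.disjoint_left.2 fun z hz hz' => hz.2 (hF hz')
  refine hLu (((hL'.union (hL'.biUnion hcon)).union (countable_iUnion fun F : Finset I =>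
    countable_iUnion fun hF => (hfin F hF).countable)).mono fun z hz => ?_)
  by_cases hzL : z ∈ derivedSet L
  · exact Or.inl (Or.inl hzL)
  by_cases hzZ : ∃ x ∈ derivedSet L, z ∈ Z x
  · obtain ⟨x, hx, hzx⟩ := hzZ
    exact Or.inl (Or.inr (mem_biUnion hx ⟨⟨hzx, hz⟩, hzL⟩))
  · right
    push Not at hzZ
    have hex : ∀ x ∈ derivedSet L, ∃ y ∈ derivedSet L, y ≠ x ∧ z ∉ V x y := by
      intro x hx
      have := hzZ x hx
      simp only [Z, mem_iInter, not_forall] at this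
      obtain ⟨y, hy, hzy⟩ := this
      exact ⟨y, hy.1, hy.2, hzy⟩
    choose! y hy hyx hzy using hex
    have hc : IsCompact (derivedSet L) := (isClosed_derivedSet L).isCompact
    obtain ⟨t, ht⟩ := hc.elim_finite_subcover
      (fun x : derivedSet L => interior (V x (y x))) (fun _ => isOpen_interior) fun x hx =>
        mem_iUnion.2 ⟨⟨x, hx⟩, mem_interior_iff_mem_nhds.2 (hVn _ _ (hyx x hx).symm)⟩
    classical
    let F : Finset I := t.image fun x => ⟨(x, ⟨y x, hy x x.2⟩), fun h =>
      hyx x x.2 (congrArg Subtype.val h).symm⟩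
    have hFt : (⋃ i ∈ F, interior (V i.1.1 i.1.2)) = ⋃ x ∈ t, interior (V x (y x)) := by
      simp only [F, Finset.set_biUnion_finset_image]
    refine mem_iUnion₂.2 ⟨F, by rw [hFt]; exact ht, hz, ?_⟩
    rw [hFt]
    simp only [mem_iUnion, not_exists]
    exact fun x _ hzx => hzy x x.2 (interior_subset hzx)

/-- A nonmetrizable compact space of finite height has a closed subset `L` (a derived set of `K`)
with uncountably many isolated points converging to some `x ∈ L`. -/
lemma exists_uncountable_converging [CompactSpace K] [T2Space K] (hK : omegaDerivedSet K = ∅)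
    (hKm : ¬ TopologicalSpace.MetrizableSpace K) :
    ∃ L : Set K, IsClosed L ∧ ∃ x ∈ derivedSet L, ∃ Γ ⊆ L \ derivedSet L,
      ¬ Γ.Countable ∧ ∀ U ∈ 𝓝 x, (Γ \ U).Finite := by
  have hunc : ¬ (derivedSet^[0] (univ : Set K)).Countable := fun h => by
    have : Countable K := countable_univ_iff.1 h
    exact hKm metrizableSpace_of_countable_of_compactSpace
  have hex : ∃ n, (derivedSet^[n] (univ : Set K)).Countable := by
    obtain ⟨n, hn⟩ := exists_iterate_derivedSet_eq_empty hK
    exact ⟨n, by simp [hn]⟩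
  classical
  -- `k` is the last level that is still uncountable
  obtain ⟨k, hk⟩ : ∃ k, Nat.find hex = k + 1 :=
    Nat.exists_eq_succ_of_ne_zero fun h => hunc (h ▸ Nat.find_spec hex)
  have h1 : ¬ (derivedSet^[k] (univ : Set K)).Countable := Nat.find_min hex (by omega)
  have h2 : (derivedSet^[k + 1] (univ : Set K)).Countable := hk ▸ Nat.find_spec hex
  rw [Function.iterate_succ_apply'] at h2
  exact ⟨_, isClosed_iterate_derivedSet k,
    exists_uncountable_converging_of_countable_derivedSet (isClosed_iterate_derivedSet k) h1 h2⟩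

/-- Under the continuum hypothesis the converging family of
`exists_uncountable_converging` may be indexed by the Cantor set. -/
lemma exists_injective_tendsto_cofinite
    (CH : (Cardinal.aleph 1 : Cardinal.{0}) = Cardinal.continuum.{0})
    [CompactSpace K] [T2Space K] (hK : omegaDerivedSet K = ∅)
    (hKm : ¬ TopologicalSpace.MetrizableSpace K) :
    ∃ L : Set K, IsClosed L ∧ ∃ x ∈ derivedSet L, ∃ a : (ℕ → Bool) → K,
      Function.Injective a ∧ (∀ γ, a γ ∈ L \ derivedSet L) ∧ Tendsto a cofinite (𝓝 x) := by
  obtain ⟨L, hL, x, hx, Γ, hΓL, hΓ, hlim⟩ := exists_uncountable_converging hK hKm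
  have hcard : Cardinal.lift.{0} (Cardinal.mk Γ) ≥ Cardinal.lift (Cardinal.mk (ℕ → Bool)) := by
    have h1 : Cardinal.mk (ℕ → Bool) = Cardinal.aleph 1 := by rw [CH]; simp
    have h2 : Cardinal.aleph 1 ≤ Cardinal.mk Γ := by
      rw [← Cardinal.succ_aleph0, Order.succ_le_iff, ← not_le, Cardinal.le_aleph0_iff_set_countable]
      exact hΓ
    simpa [h1] using h2
  obtain ⟨e⟩ := Cardinal.lift_mk_le'.1 hcard
  refine ⟨L, hL, x, hx, fun γ => e γ, Subtype.val_injective.comp e.injective,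
    fun γ => hΓL (e γ).2, fun U hU => ?_⟩
  rw [mem_map, mem_cofinite]
  refine ((hlim U hU).preimage ((Subtype.val_injective.comp e.injective).injOn)).subset ?_
  exact fun γ hγ => ⟨(e γ).2, hγ⟩

/-- An infinite compact space of finite height contains a nontrivial sequence of isolated points
which converges. -/
lemma exists_converging_seq_of_isolated [CompactSpace K] [T2Space K] [Infinite K]
    (hK : omegaDerivedSet K = ∅) :
    ∃ (p : K) (d : ℕ → K), Function.Injective d ∧ (∀ n, d n ∉ derivedSet univ) ∧
      Tendsto d cofinite (𝓝 p) := by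
  obtain ⟨p, hp1, hp2⟩ : ∃ p ∈ derivedSet (univ : Set K), p ∉ derivedSet (derivedSet univ) := by
    by_contra! h
    have hfix : derivedSet (derivedSet (univ : Set K)) = derivedSet univ :=
      (derivedSet_mono _ _ (subset_univ _)).antisymm h
    have hall : ∀ n, derivedSet^[n] (derivedSet (univ : Set K)) = derivedSet univ :=
      fun n => Function.iterate_fixed hfix n
    obtain ⟨n, hn⟩ := exists_iterate_derivedSet_eq_empty hK
    have h0 := iterate_derivedSet_succ_subset (K := K) n
    rw [hn, Function.iterate_succ_apply, hall n] at h0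
    obtain ⟨x, hx⟩ := Set.Infinite.exists_accPt_principal (infinite_univ (α := K))
    exact h0 hx
  obtain ⟨V, hV, hVc, hVs⟩ : ∃ V ∈ 𝓝 p, IsClosed V ∧ V ∩ derivedSet univ ⊆ {p} := by
    rw [mem_derivedSet, accPt_iff_nhds] at hp2
    push Not at hp2
    obtain ⟨U, hU, hUp⟩ := hp2
    obtain ⟨V, hV, hVc, hVU⟩ := exists_mem_nhds_isClosed_subset hU
    exact ⟨V, hV, hVc, fun z hz => hUp z ⟨hVU hz.1, hz.2⟩⟩
  have hinf : (V \ {p}).Infinite := by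
    intro hfin
    have : AccPt p (𝓟 (V \ {p})) := by
      have h := AccPt.nhds_inter hp1 hV
      rw [inter_univ] at h
      rw [accPt_principal_iff_nhdsWithin] at h ⊢
      simpa using h
    exact (Set.Infinite.of_accPt this) hfin
  let d := hinf.natEmbedding
  refine ⟨p, fun n => d n, Subtype.val_injective.comp d.injective, fun n hn => ?_, fun U hU => ?_⟩
  · exact (d n).2.2 (hVs ⟨(d n).2.1, hn⟩)
  · rw [mem_map, mem_cofinite]
    refine ((finite_inter_diff_of_inter_derivedSet_subset isClosed_univ hVc hVs hU).preimage
      ((Subtype.val_injective.comp d.injective).injOn)).subset ?_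
    exact fun n hn => ⟨⟨(d n).2.1, mem_univ _⟩, hn⟩

end Topology

/-! ### Functionals on `C(K)` are atomic -/

section Functionals

variable {𝕜 : Type*} [RCLike 𝕜] {K : Type*} [TopologicalSpace K]

lemma exists_continuousMap_eq_one_eqOn_zero [CompactSpace K] [T2Space K] {C : Set K}
    (hC : IsClosed C) {p : K} (hp : p ∉ C) :
    ∃ f : C(K, 𝕜), f p = 1 ∧ ∀ y ∈ C, f y = 0 := by
  obtain ⟨f, hf0, hf1, -⟩ := exists_continuous_zero_one_of_isClosed hC
    (isClosed_singleton (x := p)) (by simpa using hp)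
  refine ⟨⟨fun y => (f y : 𝕜), RCLike.continuous_ofReal.comp f.continuous⟩, ?_, ?_⟩
  · simp [hf1 rfl]
  · intro y hy
    simp [hf0 hy]

/-- A point `p` of a closed set `L` that is isolated in `L` has a peak function on `L`. -/
lemma exists_peak [CompactSpace K] [T2Space K] {L : Set K} (hL : IsClosed L) {p : K}
    (hp : p ∉ derivedSet L) :
    ∃ f : C(K, 𝕜), f p = 1 ∧ (∀ y ∈ L, y ≠ p → f y = 0) := by
  have hC : IsClosed (L \ {p}) := by
    rw [isClosed_iff_derivedSet_subset]
    intro z hz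
    have hz' := derivedSet_mono _ _ sdiff_subset hz
    exact ⟨(isClosed_iff_derivedSet_subset L).1 hL hz', fun h => hp (by rwa [← show z = p from h])⟩
  obtain ⟨f, h1, h0⟩ := exists_continuousMap_eq_one_eqOn_zero (𝕜 := 𝕜) hC
    (show p ∉ L \ {p} from fun h => h.2 rfl)
  exact ⟨f, h1, fun y hy hyp => h0 y ⟨hy, hyp⟩⟩

/-- A functional on `C(K)` that only depends on the restriction to `L` is bounded by the supremum
norm on `L`, because functions can be truncated outside `L`. -/
lemma norm_apply_le_of_forall_eqOn_zero [CompactSpace K] {L : Set K} {μ : C(K, 𝕜) →L[𝕜] 𝕜}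
    (hμ : ∀ f : C(K, 𝕜), (∀ y ∈ L, f y = 0) → μ f = 0) {f : C(K, 𝕜)} {M : ℝ} (hM : 0 ≤ M)
    (hf : ∀ y ∈ L, ‖f y‖ ≤ M) : ‖μ f‖ ≤ ‖μ‖ * M := by
  rcases hM.eq_or_lt with rfl | hM
  · rw [hμ f fun y hy => norm_le_zero_iff.1 (hf y hy)]
    simp
  have hpos : ∀ y, 0 < max M ‖f y‖ := fun y => lt_max_of_lt_left hM
  let g : C(K, 𝕜) := ⟨fun y => ((M / max M ‖f y‖ : ℝ) : 𝕜) * f y, by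
    refine (RCLike.continuous_ofReal.comp ?_).mul f.continuous
    exact continuous_const.div (continuous_const.max f.continuous.norm) fun y => (hpos y).ne'⟩
  have hg : ‖g‖ ≤ M := by
    refine (ContinuousMap.norm_le _ hM.le).2 fun y => ?_
    change ‖((M / max M ‖f y‖ : ℝ) : 𝕜) * f y‖ ≤ M
    rw [norm_mul, RCLike.norm_ofReal, abs_of_nonneg (div_nonneg hM.le (hpos y).le), div_mul_eq_mul_div,
      div_le_iff₀ (hpos y)]
    exact mul_le_mul_of_nonneg_left (le_max_right _ _) hM.le
  have hfg : μ f = μ g := by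
    rw [← sub_eq_zero, ← map_sub]
    refine hμ _ fun y hy => ?_
    change f y - ((M / max M ‖f y‖ : ℝ) : 𝕜) * f y = 0
    rw [max_eq_left (hf y hy), div_self hM.ne']
    simp
  rw [hfg]
  exact (μ.le_opNorm g).trans (mul_le_mul_of_nonneg_left hg (norm_nonneg _))

/-- A functional carried by the closed set `L` agrees, on functions vanishing on the derived set of
`L`, with a summable combination of point evaluations at the isolated points of `L`. -/
lemma exists_hasSum_of_eqOn_derivedSet [CompactSpace K] [T2Space K] {L : Set K} (hL : IsClosed L)
    {μ : C(K, 𝕜) →L[𝕜] 𝕜} (hμ : ∀ f : C(K, 𝕜), (∀ y ∈ L, f y = 0) → μ f = 0) :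
    ∃ a : K → 𝕜, Summable (fun p => ‖a p‖) ∧
      ∀ f : C(K, 𝕜), (∀ y ∈ derivedSet L, f y = 0) → HasSum (fun p => a p * f p) (μ f) := by
  classical
  have hpk : ∀ p : K, ∃ e : C(K, 𝕜), (∀ y ∈ L, y ≠ p → e y = 0) ∧ ‖e p‖ ≤ 1 ∧
      (p ∈ L → p ∉ derivedSet L → e p = 1) := by
    intro p
    by_cases hp : p ∈ derivedSet L
    · exact ⟨0, by simp, by simp, fun _ h => absurd hp h⟩
    · obtain ⟨e, h1, h0⟩ := exists_peak (𝕜 := 𝕜) hL hp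
      exact ⟨e, h0, by simp [h1], fun _ _ => h1⟩
  choose e he0 he1 hep using hpk
  have hsum : ∀ (c : K → 𝕜) (F : Finset K), ∀ y ∈ L,
      (∑ p ∈ F, c p • e p) y = if y ∈ F then c y * e y y else 0 := by
    intro c F y hy
    rw [ContinuousMap.sum_apply]
    rw [← Finset.sum_ite_eq F y fun p => c p * e p y]
    refine Finset.sum_congr rfl fun p _ => ?_
    split_ifs with h
    · rfl
    · simp [he0 p y hy h]
  refine ⟨fun p => μ (e p), summable_of_sum_le (c := ‖μ‖) (fun _ => norm_nonneg _) fun F => ?_,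
    fun f hf => ?_⟩
  · -- test `μ` against a combination of peak functions with unimodular coefficients
    have hθ : ∀ z : 𝕜, ∃ θ : 𝕜, ‖θ‖ ≤ 1 ∧ θ * z = (‖z‖ : 𝕜) := fun z => by
      by_cases hz : z = 0
      · exact ⟨0, by simp, by simp [hz]⟩
      · refine ⟨(‖z‖ : 𝕜) / z, ?_, div_mul_cancel₀ _ hz⟩
        rw [norm_div, RCLike.norm_ofReal, abs_norm, div_self (norm_ne_zero_iff.2 hz)]
    choose θ hθ1 hθ using hθ
    have h1 : μ (∑ p ∈ F, θ (μ (e p)) • e p) = ((∑ p ∈ F, ‖μ (e p)‖ : ℝ) : 𝕜) := by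
      simp [map_sum, hθ]
    have h2 := norm_apply_le_of_forall_eqOn_zero hμ (f := ∑ p ∈ F, θ (μ (e p)) • e p) zero_le_one
      fun y hy => by
        rw [hsum _ F y hy]
        split_ifs
        · rw [norm_mul]
          exact mul_le_one₀ (hθ1 _) (norm_nonneg _) (he1 y)
        · simp
    rw [h1, RCLike.norm_ofReal, mul_one] at h2
    exact (le_abs_self _).trans h2
  · -- subtracting finitely many peak functions makes `f` uniformly small on `L`
    rw [HasSum, SummationFilter.unconditional_filter, Metric.tendsto_atTop]
    intro ε hε
    obtain ⟨δ, hδ, hδε⟩ : ∃ δ > 0, ‖μ‖ * δ < ε :=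
      ⟨ε / (‖μ‖ + 1), by positivity, by
        rw [mul_div_assoc', div_lt_iff₀ (by positivity)]
        nlinarith [norm_nonneg μ]⟩
    have hfin : (L ∩ {y | δ ≤ ‖f y‖}).Finite := by
      refine IsCompact.finite_of_disjoint_derivedSet (A := L) ?_ inter_subset_left ?_
      · exact (hL.inter (isClosed_le continuous_const f.continuous.norm)).isCompact
      · refine Set.disjoint_left.2 fun y hy hy' => ?_
        have := hy.2
        rw [mem_ofPred_eq, hf y hy', norm_zero] at this
        exact hδ.not_ge this
    refine ⟨hfin.toFinset, fun F hF => ?_⟩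
    have h1 : μ (f - ∑ p ∈ F, f p • e p) = μ f - ∑ p ∈ F, μ (e p) * f p := by
      simp [map_sum, mul_comm]
    rw [dist_comm, dist_eq_norm, ← h1]
    refine (norm_apply_le_of_forall_eqOn_zero hμ hδ.le fun y hy => ?_).trans_lt hδε
    rw [ContinuousMap.sub_apply, hsum _ F y hy]
    by_cases hy' : y ∈ derivedSet L
    · simp [hf y hy', hδ.le]
    by_cases hyF : y ∈ F
    · simp [hyF, hep y hy hy', hδ.le]
    · rw [if_neg hyF, sub_zero]
      by_contra! h
      exact hyF (hF (by simpa using ⟨hy, h.le⟩))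

/-- Every functional on `C(K)`, for `K` of finite height, is a summable combination of point
evaluations: its atoms on the isolated points of each derived set are split off in turn. -/
lemma exists_hasSum_apply [CompactSpace K] [T2Space K] (hK : omegaDerivedSet K = ∅)
    (μ : C(K, 𝕜) →L[𝕜] 𝕜) :
    ∃ a : K → 𝕜, Summable (fun p => ‖a p‖) ∧
      ∀ f : C(K, 𝕜), HasSum (fun p => a p * f p) (μ f) := by
  have key : ∀ n, ∃ a : K → 𝕜, Summable (fun p => ‖a p‖) ∧
      ∀ f : C(K, 𝕜), (∀ y ∈ derivedSet^[n] (univ : Set K), f y = 0) →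
        HasSum (fun p => a p * f p) (μ f) := by
    intro n
    induction n with
    | zero =>
      refine ⟨0, by simp, fun f hf => ?_⟩
      have : f = 0 := ContinuousMap.ext fun y => hf y (mem_univ y)
      simp [this, hasSum_zero]
    | succ n ih =>
      obtain ⟨a, ha, haf⟩ := ih
      have hevn : ∀ p : K, ‖(ContinuousMap.evalCLM 𝕜 p : C(K, 𝕜) →L[𝕜] 𝕜)‖ ≤ 1 := fun p =>
        ContinuousLinearMap.opNorm_le_bound _ zero_le_one fun f => by
          simpa using f.norm_coe_le_norm p
      have hs : Summable fun p => a p • (ContinuousMap.evalCLM 𝕜 p : C(K, 𝕜) →L[𝕜] 𝕜) := by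
        refine Summable.of_norm_bounded ha fun p => ?_
        rw [norm_smul]
        exact mul_le_of_le_one_right (norm_nonneg _) (hevn p)
      set ν : C(K, 𝕜) →L[𝕜] 𝕜 := ∑' p, a p • ContinuousMap.evalCLM 𝕜 p with hν
      have hνf : ∀ f : C(K, 𝕜), HasSum (fun p => a p * f p) (ν f) := fun f => by
        simpa using (ContinuousLinearMap.apply 𝕜 𝕜 f).hasSum hs.hasSum
      obtain ⟨b, hb, hbf⟩ := exists_hasSum_of_eqOn_derivedSet (isClosed_iterate_derivedSet n)
        (μ := μ - ν) fun f hf => by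
          rw [sub_apply, sub_eq_zero]
          exact (haf f hf).unique (hνf f)
      refine ⟨a + b, (ha.add hb).of_nonneg_of_le (fun _ => norm_nonneg _) fun p => norm_add_le _ _,
        fun f hf => ?_⟩
      rw [Function.iterate_succ_apply'] at hf
      simpa [add_mul] using (hνf f).add (hbf f hf)
  obtain ⟨n, hn⟩ := exists_iterate_derivedSet_eq_empty hK
  obtain ⟨a, ha, haf⟩ := key n
  exact ⟨a, ha, fun f => haf f (by simp [hn])⟩

/-- A functional on `C(K)`, for `K` of finite height, is given by two sequences: one of weights and
one of points. -/
lemma exists_seq_hasSum_apply [CompactSpace K] [T2Space K] [Nonempty K]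
    (hK : omegaDerivedSet K = ∅) (μ : C(K, 𝕜) →L[𝕜] 𝕜) :
    ∃ (c : ℕ → 𝕜) (y : ℕ → K), ∀ f : C(K, 𝕜), HasSum (fun k => c k * f (y k)) (μ f) := by
  obtain ⟨a, ha, haf⟩ := exists_hasSum_apply hK μ
  have hcount : (Function.support a).Countable := by
    simpa [Function.support] using ha.countable_support
  have : Countable (Function.support a) := hcount
  obtain ⟨g, hg⟩ := exists_injective_nat (Function.support a)
  refine ⟨Function.extend g (fun p => a p) 0, Function.extend g (fun p => (p : K))
    (fun _ => Classical.arbitrary K), fun f => ?_⟩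
  have h1 : HasSum (fun p : Function.support a => a p * f p) (μ f) := by
    refine (hasSum_subtype_iff_of_support_subset ?_).2 (haf f)
    exact Function.support_mul_subset_left _ _
  rw [← hasSum_extend_zero hg] at h1
  convert h1 using 1
  funext k
  by_cases hk : ∃ p, g p = k
  · obtain ⟨p, rfl⟩ := hk
    simp [hg.extend_apply]
  · simp [Function.extend_apply' _ _ _ hk]

end Functionals

/-! ### Counting points and almost disjoint branches -/

section Counting

variable {𝕜 : Type*} [RCLike 𝕜] {K : Type*} [TopologicalSpace K]

/-- For `K` of finite height, continuum many continuous functions `f γ` cannot distinguish more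
than continuum many points. Indeed, if `n` is the last level whose derived set meets the fibre of
`y` under `(f γ)_γ`, that fibre is cut out of the derived set by a basic open set of the product
`∏_γ 𝕜`, so it is encoded by `n` together with a finite set of basic constraints. -/
lemma exists_cantor_representatives [CompactSpace K] [T2Space K] [Nonempty K]
    (hK : omegaDerivedSet K = ∅) (f : (ℕ → Bool) → C(K, 𝕜)) :
    ∃ e : (ℕ → Bool) → K, ∀ y, ∃ t, ∀ γ, f γ (e t) = f γ y := by
  classical
  obtain ⟨B, hBc, -, hB⟩ := TopologicalSpace.exists_countable_basis 𝕜
  obtain ⟨V, rfl⟩ := hBc.exists_eq_range <| by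
    obtain ⟨W, hW, -⟩ := hB.mem_nhds_iff.1 (univ_mem (f := 𝓝 (0 : 𝕜)))
    exact ⟨W, hW⟩
  let T := ℕ × Finset ((ℕ → Bool) × ℕ)
  let U : T → Set K := fun t => {z | z ∈ derivedSet^[t.1] (univ : Set K) ∧
    ∀ i ∈ t.2, f i.1 z ∈ V i.2}
  have hT : Cardinal.mk T ≤ Cardinal.mk (ℕ → Bool) := by
    simp [T, Cardinal.mk_finset_of_infinite]
  obtain ⟨s, hs⟩ : ∃ s : (ℕ → Bool) → T, Function.Surjective s :=
    have ⟨j⟩ := Cardinal.le_def _ _ |>.1 hT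
    ⟨Function.invFun j, Function.invFun_surjective j.injective⟩
  refine ⟨fun c => if h : (U (s c)).Nonempty then h.some else Classical.arbitrary K, fun y => ?_⟩
  suffices h : ∃ t : T, (U t).Nonempty ∧ ∀ z ∈ U t, ∀ γ, f γ z = f γ y by
    obtain ⟨t, ht, htU⟩ := h
    obtain ⟨c, rfl⟩ := hs t
    exact ⟨c, by simpa only [dif_pos ht] using htU _ ht.some_mem⟩
  let Φ : Set K := {z | ∀ γ, f γ z = f γ y}
  have hex : ∃ n, Disjoint (derivedSet^[n] (univ : Set K)) Φ := by
    obtain ⟨n, hn⟩ := exists_iterate_derivedSet_eq_empty hK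
    exact ⟨n, by simp [hn]⟩
  obtain ⟨n, hn⟩ : ∃ n, Nat.find hex = n + 1 :=
    Nat.exists_eq_succ_of_ne_zero fun h => by
      have h0 := Nat.find_spec hex
      rw [h] at h0
      exact Set.disjoint_left.1 h0 (mem_univ y) fun γ => rfl
  have h1 : Disjoint (derivedSet^[n + 1] (univ : Set K)) Φ := hn ▸ Nat.find_spec hex
  obtain ⟨z₀, hz₀, hz₀Φ⟩ := Set.not_disjoint_iff.1 (Nat.find_min hex (m := n) (by omega))
  have hC : IsClosed (derivedSet^[n] (univ : Set K) \ Φ) := by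
    rw [isClosed_iff_derivedSet_subset]
    intro z hz
    have hz' : z ∈ derivedSet^[n + 1] (univ : Set K) := by
      rw [Function.iterate_succ_apply']
      exact derivedSet_mono _ _ sdiff_subset hz
    exact ⟨iterate_derivedSet_succ_subset n hz', Set.disjoint_left.1 h1 hz'⟩
  have hsep : ∀ z ∈ derivedSet^[n] (univ : Set K) \ Φ, ∃ i : (ℕ → Bool) × ℕ,
      f i.1 y ∈ V i.2 ∧ f i.1 z ∉ closure (V i.2) := by
    rintro z ⟨-, hz⟩
    obtain ⟨γ, hγ⟩ : ∃ γ, f γ z ≠ f γ y := by simpa [Φ] using hz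
    obtain ⟨W, hW, hWc, hWs⟩ := exists_mem_nhds_isClosed_subset
      (isOpen_compl_singleton.mem_nhds (show f γ y ∈ ({f γ z}ᶜ : Set 𝕜) from hγ.symm))
    obtain ⟨_, ⟨k, rfl⟩, hk, hkW⟩ := hB.mem_nhds_iff.1 hW
    exact ⟨(γ, k), hk, fun h => hWs (closure_minimal hkW hWc h) rfl⟩
  choose! i hiy hiz using hsep
  obtain ⟨t, htC, ht⟩ := hC.isCompact.elim_nhds_subcover
    (fun z => {w | f (i z).1 w ∉ closure (V (i z).2)}) fun z hz =>
      (isClosed_closure.isOpen_compl.preimage (f (i z).1).continuous).mem_nhds (hiz z hz)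
  refine ⟨(n, t.image i), ⟨z₀, hz₀, fun j hj => ?_⟩, fun z hz => ?_⟩
  · obtain ⟨z, hz, rfl⟩ := Finset.mem_image.1 hj
    rw [hz₀Φ]
    exact hiy z (htC z hz)
  · by_contra hzΦ
    obtain ⟨w, hw, hzw⟩ := mem_iUnion₂.1 (ht ⟨hz.1, hzΦ⟩)
    exact hzw (subset_closure (hz.2 _ (Finset.mem_image_of_mem i hw)))

/-- The initial segments of the branch `γ` of the dyadic tree, coded as natural numbers. -/
def branchCodes (γ : ℕ → Bool) : Set ℕ :=
  range fun n => Encodable.encode ((List.range n).map γ)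

lemma infinite_branchCodes (γ : ℕ → Bool) : (branchCodes γ).Infinite := by
  refine infinite_range_of_injective fun m n h => ?_
  simpa using congrArg List.length (Encodable.encode_injective h)

/-- Distinct branches of the dyadic tree are almost disjoint. -/
lemma finite_branchCodes_inter {γ γ' : ℕ → Bool} (h : γ ≠ γ') :
    (branchCodes γ ∩ branchCodes γ').Finite := by
  obtain ⟨m, hm⟩ := Function.ne_iff.1 h
  refine ((finite_Iic m).image fun n => Encodable.encode ((List.range n).map γ)).subset ?_
  rintro _ ⟨⟨n, rfl⟩, n', hn'⟩
  refine ⟨n, ?_, rfl⟩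
  by_contra! hmn
  have hl := Encodable.encode_injective hn'
  obtain rfl : n' = n := by simpa using congrArg List.length hl
  rw [mem_Iic, not_le] at hmn
  exact hm (List.map_inj_left.1 hl m (List.mem_range.2 hmn)).symm

end Counting

/-! ### Twisted sums with `c₀` from almost disjoint families -/

section AlmostSum

variable {𝕜 : Type*} [RCLike 𝕜] {ι : Type*} {A : ι → Set ℕ}

/-- The sequence `u` represents, modulo null sequences, the sum in `ℓ_∞ / c₀` of the classes of
`g γ • 1_{A γ}`: the distance of `u` to the finite partial sums, in the seminorm `limsup ‖·‖`,
tends to `0`. -/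
def IsAlmostSum (A : ι → Set ℕ) (g : ι → 𝕜) (u : ℕ → 𝕜) : Prop :=
  ∀ δ > 0, ∃ F₀ : Finset ι, ∀ F, F₀ ⊆ F →
    ∀ᶠ n in atTop, ‖u n - ∑ γ ∈ F, (A γ).indicator (fun _ => g γ) n‖ ≤ δ

lemma IsAlmostSum.add {g g' : ι → 𝕜} {u u' : ℕ → 𝕜} (h : IsAlmostSum A g u)
    (h' : IsAlmostSum A g' u') : IsAlmostSum A (g + g') (u + u') := by
  classical
  intro δ hδ
  obtain ⟨F, hF⟩ := h (δ / 2) (half_pos hδ)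
  obtain ⟨F', hF'⟩ := h' (δ / 2) (half_pos hδ)
  refine ⟨F ∪ F', fun G hG => ?_⟩
  filter_upwards [hF G (Finset.union_subset_left hG), hF' G (Finset.union_subset_right hG)]
    with n hn hn'
  calc _ = ‖(u n - ∑ γ ∈ G, (A γ).indicator (fun _ => g γ) n) +
        (u' n - ∑ γ ∈ G, (A γ).indicator (fun _ => g' γ) n)‖ := by
        congr 1
        simp only [Pi.add_apply, indicator_add, Finset.sum_add_distrib]
        ring
    _ ≤ δ := (norm_add_le _ _).trans (by linarith)

lemma IsAlmostSum.const_mul {g : ι → 𝕜} {u : ℕ → 𝕜} (h : IsAlmostSum A g u) (c : 𝕜) :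
    IsAlmostSum A (fun γ => c * g γ) (fun n => c * u n) := by
  intro δ hδ
  obtain ⟨F, hF⟩ := h (δ / (‖c‖ + 1)) (by positivity)
  refine ⟨F, fun G hG => ?_⟩
  filter_upwards [hF G hG] with n hn
  calc _ = ‖c * (u n - ∑ γ ∈ G, (A γ).indicator (fun _ => g γ) n)‖ := by
        congr 1
        rw [mul_sub, Finset.mul_sum]
        congr 1
        refine Finset.sum_congr rfl fun γ _ => ?_
        by_cases hγ : n ∈ A γ <;> simp [hγ]
    _ ≤ ‖c‖ * (δ / (‖c‖ + 1)) := by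
        rw [norm_mul]
        exact mul_le_mul_of_nonneg_left hn (norm_nonneg _)
    _ ≤ δ := by
        rw [mul_div_assoc', div_le_iff₀ (by positivity)]
        nlinarith [norm_nonneg c]

lemma isAlmostSum_zero_iff {u : ℕ → 𝕜} :
    IsAlmostSum A (0 : ι → 𝕜) u ↔ Tendsto u atTop (𝓝 0) := by
  have h0 : ∀ (F : Finset ι) n, ∑ γ ∈ F, (A γ).indicator (fun _ => (0 : ι → 𝕜) γ) n = 0 := by
    simp
  constructor
  · intro h
    rw [Metric.tendsto_nhds]
    intro ε hε
    obtain ⟨F, hF⟩ := h (ε / 2) (half_pos hε)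
    filter_upwards [hF F subset_rfl] with n hn
    rw [h0, sub_zero] at hn
    rw [dist_zero_right]
    linarith
  · intro h δ hδ
    refine ⟨∅, fun F _ => ?_⟩
    filter_upwards [Metric.tendsto_nhds.1 h δ hδ] with n hn
    rw [h0, sub_zero]
    rw [dist_zero_right] at hn
    exact hn.le

/-- Members of a finite part of an almost disjoint family are eventually disjoint. -/
lemma eventually_eq_of_almostDisjoint (hA : ∀ γ γ', γ ≠ γ' → (A γ ∩ A γ').Finite) (F : Finset ι) :
    ∀ᶠ n in atTop, ∀ γ ∈ F, ∀ γ' ∈ F, n ∈ A γ → n ∈ A γ' → γ = γ' := by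
  rw [Filter.eventually_all_finset]
  intro γ _
  rw [Filter.eventually_all_finset]
  intro γ' _
  by_cases h : γ = γ'
  · simp [h]
  · rw [← Nat.cofinite_eq_atTop]
    filter_upwards [(hA γ γ' h).compl_mem_cofinite] with n hn h1 h2
    exact absurd ⟨h1, h2⟩ hn

lemma sum_indicator_eq_of_mem {g : ι → 𝕜} {F : Finset ι} {n : ℕ}
    (hn : ∀ γ ∈ F, ∀ γ' ∈ F, n ∈ A γ → n ∈ A γ' → γ = γ') {γ : ι} (hγ : γ ∈ F) (hnγ : n ∈ A γ) :
    ∑ γ ∈ F, (A γ).indicator (fun _ => g γ) n = g γ := by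
  rw [Finset.sum_eq_single γ]
  · simp [hnγ]
  · intro γ' hγ' hne
    exact indicator_of_notMem (fun h => hne (hn _ hγ' _ hγ h hnγ)) _
  · exact fun h => absurd hγ h

lemma sum_indicator_eq_zero {g : ι → 𝕜} {F : Finset ι} {n : ℕ} (hn : ∀ γ ∈ F, n ∉ A γ) :
    ∑ γ ∈ F, (A γ).indicator (fun _ => g γ) n = 0 :=
  Finset.sum_eq_zero fun γ hγ => indicator_of_notMem (hn γ hγ) _

lemma eventually_norm_sum_indicator_le (hA : ∀ γ γ', γ ≠ γ' → (A γ ∩ A γ').Finite)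
    {g : ι → 𝕜} {M : ℝ} (hM : 0 ≤ M) (hg : ∀ γ, ‖g γ‖ ≤ M) (F : Finset ι) :
    ∀ᶠ n in atTop, ‖∑ γ ∈ F, (A γ).indicator (fun _ => g γ) n‖ ≤ M := by
  filter_upwards [eventually_eq_of_almostDisjoint hA F] with n hn
  by_cases h : ∃ γ ∈ F, n ∈ A γ
  · obtain ⟨γ, hγ, hnγ⟩ := h
    rw [sum_indicator_eq_of_mem hn hγ hnγ]
    exact hg γ
  · push Not at h
    rw [sum_indicator_eq_zero h, norm_zero]
    exact hM

/-- If `g` tends to zero, then the sum of the classes of `g γ • 1_{A γ}` exists in `ℓ_∞ / c₀`. A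
representing sequence takes at `n` the value `g γ` of largest norm among the `γ` with
`n ∈ A γ`. -/
lemma exists_isAlmostSum (hA : ∀ γ γ', γ ≠ γ' → (A γ ∩ A γ').Finite) {g : ι → 𝕜}
    (hg : Tendsto g cofinite (𝓝 0)) {M : ℝ} (hM : 0 ≤ M) (hgM : ∀ γ, ‖g γ‖ ≤ M) :
    ∃ u : ℕ → 𝕜, (∀ n, ‖u n‖ ≤ M) ∧ IsAlmostSum A g u := by
  have hfin : ∀ ε > 0, {γ | ε ≤ ‖g γ‖}.Finite := fun ε hε => by
    have := Metric.tendsto_nhds.1 hg ε hε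
    simpa [Filter.eventually_cofinite, dist_zero_right] using this
  have hmax : ∀ n, ∃ v : 𝕜, (v = 0 ∨ ∃ γ, n ∈ A γ ∧ v = g γ) ∧ ∀ γ, n ∈ A γ → ‖g γ‖ ≤ ‖v‖ := by
    intro n
    by_cases h : ∃ γ, n ∈ A γ ∧ g γ ≠ 0
    · obtain ⟨γ₀, hn₀, hγ₀⟩ := h
      obtain ⟨γ, ⟨hnγ, hle⟩, hγ⟩ := Set.exists_max_image {γ | n ∈ A γ ∧ ‖g γ₀‖ ≤ ‖g γ‖}
        (fun γ => ‖g γ‖) ((hfin _ (norm_pos_iff.2 hγ₀)).subset fun γ h => h.2) ⟨γ₀, hn₀, le_rfl⟩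
      refine ⟨g γ, Or.inr ⟨γ, hnγ, rfl⟩, fun γ' hn' => ?_⟩
      rcases le_total ‖g γ₀‖ ‖g γ'‖ with h | h
      · exact hγ γ' ⟨hn', h⟩
      · exact h.trans hle
    · push Not at h
      exact ⟨0, Or.inl rfl, fun γ hγ => by simp [h γ hγ]⟩
  choose u hu hmax using hmax
  refine ⟨u, fun n => ?_, fun δ hδ => ?_⟩
  · rcases hu n with h | ⟨γ, -, h⟩
    · simpa [h] using hM
    · simpa [h] using hgM γ
  · refine ⟨(hfin (δ / 2) (half_pos hδ)).toFinset, fun F hF => ?_⟩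
    have hout : ∀ γ, γ ∉ F → ‖g γ‖ ≤ δ / 2 := fun γ hγ => by
      by_contra! h
      exact hγ (hF (by simpa using h.le))
    filter_upwards [eventually_eq_of_almostDisjoint hA F] with n hn
    by_cases h : ∃ γ ∈ F, n ∈ A γ
    · obtain ⟨γ, hγ, hnγ⟩ := h
      rw [sum_indicator_eq_of_mem hn hγ hnγ]
      rcases hu n with h | ⟨γ₁, hn₁, h⟩
      · have := hmax n γ hnγ
        rw [h, norm_zero] at this
        rw [h, norm_le_zero_iff.1 this]
        simpa using hδ.le
      · by_cases h₁ : γ₁ ∈ F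
        · rw [h, hn _ h₁ _ hγ hn₁ hnγ, sub_self, norm_zero]
          exact hδ.le
        · have h2 : ‖u n‖ ≤ δ / 2 := h ▸ hout γ₁ h₁
          calc _ ≤ ‖u n‖ + ‖g γ‖ := norm_sub_le _ _
            _ ≤ δ := by linarith [hmax n γ hnγ]
    · push Not at h
      rw [sum_indicator_eq_zero h, sub_zero]
      rcases hu n with h' | ⟨γ₁, hn₁, h'⟩
      · simpa [h'] using hδ.le
      · rw [h']
        exact (hout γ₁ fun h₁ => h _ h₁ hn₁).trans (by linarith)

end AlmostSum

section TwistedSum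

variable {𝕜 : Type w} [RCLike 𝕜]

/-- A complemented kernel provides a bounded linear section of the quotient map. -/
lemma IsShortExact.exists_section {Y X Z : Type*} [NormedAddCommGroup Y] [NormedSpace 𝕜 Y]
    [NormedAddCommGroup X] [NormedSpace 𝕜 X] [NormedAddCommGroup Z] [NormedSpace 𝕜 Z]
    [CompleteSpace X] [CompleteSpace Z] {i : Y →L[𝕜] X} {q : X →L[𝕜] Z} (h : IsShortExact i q)
    (hc : (LinearMap.range i.toLinearMap).ClosedComplemented) :
    ∃ s : Z →L[𝕜] X, ∀ z, q (s z) = z := by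
  obtain ⟨P, hP⟩ := hc
  obtain ⟨C, -, hC⟩ := ContinuousLinearMap.exists_preimage_norm_le q h.surjective
  choose x hx hxC using hC
  -- `T` is the projection along the kernel of `q`; it only depends on the value of `q`
  let T : X →L[𝕜] X := ContinuousLinearMap.id 𝕜 X - (Submodule.subtypeL _).comp P
  have hqT : ∀ x, q (T x) = q x := fun x => by
    have : q (P x : X) = 0 := (h.exact _).2 (P x).2
    simp [T, this]
  have hT : ∀ x x', q x = q x' → T x = T x' := fun x x' hxx' => by
    have hmem : x - x' ∈ LinearMap.range i.toLinearMap :=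
      (h.exact _).1 (by rw [map_sub, hxx', sub_self])
    have h2 := congrArg Subtype.val (hP ⟨x - x', hmem⟩)
    rw [← sub_eq_zero, ← map_sub]
    simpa [T, sub_eq_zero] using h2.symm
  let s : Z →ₗ[𝕜] X :=
    { toFun := fun z => T (x z)
      map_add' := fun z z' => by
        rw [← map_add]
        exact hT _ _ (by simp [hx])
      map_smul' := fun c z => by
        rw [RingHom.id_apply, ← map_smul]
        exact hT _ _ (by simp [hx]) }
  refine ⟨s.mkContinuous (‖T‖ * C) fun z => ?_, fun z => (hqT _).trans (hx z)⟩
  rw [mul_assoc]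
  exact (T.le_opNorm _).trans (mul_le_mul_of_nonneg_left (hxC z) (norm_nonneg _))

variable {X : Type u} [NormedAddCommGroup X] [NormedSpace 𝕜 X] {ι : Type*}

/-- The pullback of `0 → c₀ → ℓ_∞ → ℓ_∞ / c₀ → 0` along the operator `X → ℓ_∞ / c₀` which sends `f`
to the sum of the classes of `r γ f • 1_{A γ}`. -/
def twistedSum (A : ι → Set ℕ) (r : ι → X →L[𝕜] 𝕜) :
    Submodule 𝕜 (X × BoundedContinuousFunction ℕ 𝕜) where
  carrier := {p | IsAlmostSum A (fun γ => r γ p.1) p.2}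
  zero_mem' := by
    have := (isAlmostSum_zero_iff (A := A) (u := fun _ => (0 : 𝕜))).2 tendsto_const_nhds
    simpa using! this
  add_mem' {p p'} h h' := by
    have := IsAlmostSum.add h h'
    simpa using! this
  smul_mem' c p h := by
    have := IsAlmostSum.const_mul h c
    simpa using! this

lemma mem_twistedSum {A : ι → Set ℕ} {r : ι → X →L[𝕜] 𝕜}
    {p : X × BoundedContinuousFunction ℕ 𝕜} :
    p ∈ twistedSum A r ↔ IsAlmostSum A (fun γ => r γ p.1) p.2 := Iff.rfl

lemma isClosed_twistedSum {A : ι → Set ℕ} (hA : ∀ γ γ', γ ≠ γ' → (A γ ∩ A γ').Finite)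
    {r : ι → X →L[𝕜] 𝕜} {C : ℝ} (hC : 0 ≤ C) (hr : ∀ γ f, ‖r γ f‖ ≤ C * ‖f‖) :
    IsClosed (twistedSum A r : Set (X × BoundedContinuousFunction ℕ 𝕜)) := by
  refine isClosed_of_closure_subset fun p hp δ hδ => ?_
  obtain ⟨η, hη, hηδ⟩ : ∃ η > 0, (C + 1) * η ≤ δ / 2 :=
    ⟨δ / 2 / (C + 1), by positivity, le_of_eq (by field_simp)⟩
  obtain ⟨p', hp', hdist⟩ := Metric.mem_closure_iff.1 hp η hη
  rw [dist_eq_norm] at hdist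
  have h1 : ‖p.1 - p'.1‖ ≤ η := (norm_fst_le (p - p')).trans hdist.le
  have h2 : ‖p.2 - p'.2‖ ≤ η := (norm_snd_le (p - p')).trans hdist.le
  obtain ⟨F₀, hF₀⟩ := hp' (δ / 2) (half_pos hδ)
  refine ⟨F₀, fun F hF => ?_⟩
  filter_upwards [hF₀ F hF, eventually_norm_sum_indicator_le hA (M := C * η) (by positivity)
    (fun γ => (hr γ (p.1 - p'.1)).trans (mul_le_mul_of_nonneg_left h1 hC)) F] with n hn hn'
  have h3 : ‖p.2 n - p'.2 n‖ ≤ η := ((p.2 - p'.2).norm_coe_le_norm n).trans h2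
  calc _ = ‖(p'.2 n - ∑ γ ∈ F, (A γ).indicator (fun _ => r γ p'.1) n) + (p.2 n - p'.2 n) -
        ∑ γ ∈ F, (A γ).indicator (fun _ => r γ (p.1 - p'.1)) n‖ := by
        congr 1
        simp only [map_sub, indicator_sub, Finset.sum_sub_distrib]
        ring
    _ ≤ δ := (norm_sub_le _ _).trans <| by
        have := norm_add_le (p'.2 n - ∑ γ ∈ F, (A γ).indicator (fun _ => r γ p'.1) n)
          (p.2 n - p'.2 n)
        linarith

/-- The inclusion `a ↦ (0, a)` of `c₀` in the twisted sum. -/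
noncomputable def twistedSumInl (A : ι → Set ℕ) (r : ι → X →L[𝕜] 𝕜) :
    ZeroAtInftyContinuousMap ℕ 𝕜 →L[𝕜] twistedSum A r :=
  LinearMap.mkContinuous
    { toFun := fun a => ⟨(0, a.toBCF), by
        have := (isAlmostSum_zero_iff (A := A) (u := a)).2 (by simpa using! a.zero_at_infty')
        rw [mem_twistedSum]
        simpa using! this⟩
      map_add' := fun a b => Subtype.ext (Prod.ext (add_zero 0).symm rfl)
      map_smul' := fun c a => Subtype.ext (Prod.ext (smul_zero c).symm rfl) } 1 fun a => by
    change ‖((0 : X), a.toBCF)‖ ≤ 1 * ‖a‖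
    simp [Prod.norm_def]

lemma isShortExact_twistedSum {A : ι → Set ℕ} (hA : ∀ γ γ', γ ≠ γ' → (A γ ∩ A γ').Finite)
    {r : ι → X →L[𝕜] 𝕜} {C : ℝ} (hC : 0 ≤ C) (hr : ∀ γ f, ‖r γ f‖ ≤ C * ‖f‖)
    (hr0 : ∀ f, Tendsto (fun γ => r γ f) cofinite (𝓝 0)) :
    IsShortExact (twistedSumInl A r)
      ((ContinuousLinearMap.fst 𝕜 X _).comp (twistedSum A r).subtypeL) where
  injective a b hab := ZeroAtInftyContinuousMap.toBCF_injective _ _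
    (congrArg (fun p : twistedSum A r => p.1.2) hab)
  exact := by
    rintro ⟨⟨f, u⟩, hp⟩
    constructor
    · intro h
      obtain rfl : f = 0 := h
      have h0 : Tendsto u (cocompact ℕ) (𝓝 0) := by
        rw [cocompact_eq_cofinite, Nat.cofinite_eq_atTop]
        exact (isAlmostSum_zero_iff (A := A)).1 (by simpa [mem_twistedSum] using! hp)
      exact ⟨⟨u.toContinuousMap, h0⟩, rfl⟩
    · rintro ⟨a, ha⟩
      exact (congrArg (fun p : twistedSum A r => p.1.1) ha).symm
  surjective f := by
    obtain ⟨u, huM, hu⟩ := exists_isAlmostSum hA (hr0 f) (by positivity) fun γ => hr γ f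
    exact ⟨⟨(f, BoundedContinuousFunction.ofNormedAddCommGroupDiscrete u _ huM), hu⟩, rfl⟩

/-- If `Ext(X, c₀) = 0`, the operator `X → ℓ_∞ / c₀` defining the twisted sum lifts to a sequence of
functionals. -/
lemma exists_isAlmostSum_of_extEqZero [CompleteSpace X]
    (hX : ExtEqZero 𝕜 X (ZeroAtInftyContinuousMap ℕ 𝕜)) {A : ι → Set ℕ}
    (hA : ∀ γ γ', γ ≠ γ' → (A γ ∩ A γ').Finite)
    {r : ι → X →L[𝕜] 𝕜} {C : ℝ} (hC : 0 ≤ C) (hr : ∀ γ f, ‖r γ f‖ ≤ C * ‖f‖)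
    (hr0 : ∀ f, Tendsto (fun γ => r γ f) cofinite (𝓝 0)) :
    ∃ μ : ℕ → X →L[𝕜] 𝕜, ∀ f, IsAlmostSum A (fun γ => r γ f) (fun n => μ n f) := by
  have : CompleteSpace (twistedSum A r) := (isClosed_twistedSum hA hC hr).completeSpace_coe
  have hex := isShortExact_twistedSum hA hC hr hr0
  obtain ⟨s, hs⟩ := hex.exists_section (hX (twistedSum A r) _ _ hex)
  refine ⟨fun n => (BoundedContinuousFunction.evalCLM 𝕜 n).comp
    ((ContinuousLinearMap.snd 𝕜 X _).comp ((twistedSum A r).subtypeL.comp s)), fun f => ?_⟩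
  have h1 := (s f).2
  rw [mem_twistedSum, show (s f).1.1 = f from hs f] at h1
  exact h1

end TwistedSum

/-! ### Nontrivial twisted sums with `c₀` and with `C(S)` -/

section NonTrivial

/-- For `K` nonmetrizable of finite height, some twisted sum of `c₀` and `C(K)` does not split. Each
subset `σ` of the Cantor set gives an operator `C(K) → ℓ_∞ / c₀`; a lifting of it determines `σ`
through its matrix of values at the peak functions `f γ`, and there are only continuum many
matrices, since functionals are atomic and the `f γ` distinguish only continuum many points. -/
theorem not_extEqZero_zeroAtInfty (CH : (Cardinal.aleph 1 : Cardinal.{0}) = Cardinal.continuum.{0})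
    (𝕜 : Type w) [RCLike 𝕜] (K : Type u) [TopologicalSpace K] [CompactSpace K] [T2Space K]
    (hK : omegaDerivedSet K = ∅) (hKm : ¬ TopologicalSpace.MetrizableSpace K) :
    ¬ ExtEqZero 𝕜 C(K, 𝕜) (ZeroAtInftyContinuousMap ℕ 𝕜) := by
  classical
  intro hExt
  obtain ⟨L, hL, x, hx, a, ha, haL, hlim⟩ := exists_injective_tendsto_cofinite CH hK hKm
  have : Nonempty K := ⟨x⟩
  have hpk : ∀ γ, ∃ f : C(K, 𝕜), f (a γ) = 1 ∧ ∀ y ∈ L, y ≠ a γ → f y = 0 := fun γ =>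
    exists_peak hL (haL γ).2
  choose f hf1 hf0 using hpk
  have hfa : ∀ γ γ', γ' ≠ γ → f γ (a γ') = 0 := fun γ γ' h => hf0 γ _ (haL γ').1 (ha.ne h)
  have hfx : ∀ γ, f γ x = 0 := fun γ =>
    hf0 γ x ((isClosed_iff_derivedSet_subset L).1 hL hx) fun h => (haL γ).2 (h ▸ hx)
  let r : Set (ℕ → Bool) → (ℕ → Bool) → C(K, 𝕜) →L[𝕜] 𝕜 := fun σ γ =>
    if γ ∈ σ then ContinuousMap.evalCLM 𝕜 (a γ) - ContinuousMap.evalCLM 𝕜 x else 0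
  have hrapp : ∀ σ γ g, r σ γ g = if γ ∈ σ then g (a γ) - g x else 0 := fun σ γ g => by
    simp only [r]
    split_ifs <;> simp
  have hr : ∀ σ γ g, ‖r σ γ g‖ ≤ 2 * ‖g‖ := fun σ γ g => by
    rw [hrapp]
    split_ifs
    · refine (norm_sub_le _ _).trans ?_
      linarith [g.norm_coe_le_norm (a γ), g.norm_coe_le_norm x]
    · simp
  have hr0 : ∀ σ g, Tendsto (fun γ => r σ γ g) cofinite (𝓝 0) := fun σ g => by
    have h1 : Tendsto (fun γ => g (a γ) - g x) cofinite (𝓝 0) := by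
      simpa using ((g.continuous.tendsto x).comp hlim).sub_const (g x)
    refine squeeze_zero_norm (fun γ => ?_) (by simpa using h1.norm)
    rw [hrapp]
    split_ifs <;> simp
  choose μ hμ using fun σ => exists_isAlmostSum_of_extEqZero hExt
    (fun γ γ' => finite_branchCodes_inter) zero_le_two (hr σ) (hr0 σ)
  -- the lifting recovers `σ` from its values at the peak functions
  have hval : ∀ σ γ, Tendsto (fun n => μ σ n (f γ)) (atTop ⊓ 𝓟 (branchCodes γ))
      (𝓝 (if γ ∈ σ then 1 else 0)) := by
    intro σ γ
    rw [Metric.tendsto_nhds]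
    intro ε hε
    obtain ⟨F₀, hF₀⟩ := hμ σ (f γ) (ε / 2) (half_pos hε)
    rw [eventually_inf_principal]
    filter_upwards [hF₀ (insert γ F₀) (Finset.subset_insert _ _)] with n hn hnγ
    rw [Finset.sum_eq_single γ, indicator_of_mem hnγ, hrapp, hf1, hfx, sub_zero] at hn
    · rw [dist_eq_norm]
      linarith
    · intro γ' _ hne
      have h0 : r σ γ' (f γ) = 0 := by
        rw [hrapp, hfa _ _ hne, hfx]
        simp
      simp [h0]
    · exact fun h => absurd (Finset.mem_insert_self _ _) h
  obtain ⟨e, he⟩ := exists_cantor_representatives hK f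
  -- a code lists real and imaginary parts of the weights, and representatives of the atoms
  let D := (ℕ → ℕ → ℝ × ℝ) × (ℕ → ℕ → ℕ → Bool)
  let M : D → ℕ → (ℕ → Bool) → 𝕜 := fun d n γ =>
    ∑' k, ((d.1 n k).1 + (d.1 n k).2 * RCLike.I : 𝕜) * f γ (e (d.2 n k))
  have hM : ∀ σ, ∃ d, ∀ n γ, M d n γ = μ σ n (f γ) := by
    intro σ
    choose c y hcy using fun n => exists_seq_hasSum_apply hK (μ σ n)
    choose t ht using he
    refine ⟨(fun n k => (RCLike.re (c n k), RCLike.im (c n k)), fun n k => t (y n k)),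
      fun n γ => ?_⟩
    simp only [M, RCLike.re_add_im, ht]
    exact (hcy n (f γ)).tsum_eq
  have hD : Cardinal.mk D ≤ Cardinal.mk (ℕ → Bool) := by
    simp [D, Cardinal.mk_real]
  obtain ⟨s, hs⟩ : ∃ s : (ℕ → Bool) → D, Function.Surjective s :=
    have ⟨j⟩ := Cardinal.le_def _ _ |>.1 hD
    ⟨Function.invFun j, Function.invFun_surjective j.injective⟩
  refine Function.cantor_surjective (fun c : ℕ → Bool => {γ | ¬ Tendsto (fun n => M (s c) n γ)
    (atTop ⊓ 𝓟 (branchCodes γ)) (𝓝 0)}) fun σ => ?_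
  obtain ⟨d, hd⟩ := hM σ
  obtain ⟨c, rfl⟩ := hs d
  refine ⟨c, Set.ext fun γ => ?_⟩
  have : (atTop ⊓ 𝓟 (branchCodes γ)).NeBot := by
    rw [← Nat.cofinite_eq_atTop]
    exact cofinite_inf_principal_neBot_iff.2 (infinite_branchCodes γ)
  simp only [hd, mem_ofPred_eq]
  have h := hval σ γ
  by_cases hγ : γ ∈ σ
  · rw [if_pos hγ] at h
    exact iff_of_true (fun h0 => one_ne_zero (tendsto_nhds_unique h h0)) hγ
  · rw [if_neg hγ] at h
    exact iff_of_false (not_not.2 h) hγ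

end NonTrivial

section Retract

/-- Triviality of `Ext(Z, ·)` passes to retracts: an extension of `Z` by the retract `Y₀` of `Y`
becomes an extension by `Y` after adding the kernel of the retraction to the middle space. -/
lemma ExtEqZero.of_retract {𝕜 : Type w} [RCLike 𝕜] {Z : Type (max u w)} {Y : Type (max v w)}
    {Y₀ : Type w} [NormedAddCommGroup Z] [NormedSpace 𝕜 Z] [NormedAddCommGroup Y] [NormedSpace 𝕜 Y]
    [CompleteSpace Y] [NormedAddCommGroup Y₀] [NormedSpace 𝕜 Y₀] (h : ExtEqZero 𝕜 Z Y)
    (j : Y₀ →L[𝕜] Y) (P : Y →L[𝕜] Y₀) (hPj : ∀ y, P (j y) = y) : ExtEqZero 𝕜 Z Y₀ := by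
  intro X _ _ _ i q hex
  let W := LinearMap.ker P.toLinearMap
  have : CompleteSpace W := P.isClosed_ker.completeSpace_coe
  let π : Y →L[𝕜] W := (ContinuousLinearMap.id 𝕜 Y - j.comp P).codRestrict W fun y => by
    simp [W, hPj]
  have hπ : ∀ y, (π y : Y) = y - j (P y) := fun y => rfl
  let i' : Y →L[𝕜] X × W := (i.comp P).prod π
  let q' : X × W →L[𝕜] Z := q.comp (ContinuousLinearMap.fst 𝕜 X W)
  have hi' : ∀ y, i' y = (i (P y), π y) := fun y => rfl
  have hex' : IsShortExact i' q' := by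
    refine ⟨fun y y' hyy => ?_, ?_, fun z => ?_⟩
    · rw [hi', hi', Prod.mk.injEq] at hyy
      have h1 := hex.injective hyy.1
      have h2 := congrArg Subtype.val hyy.2
      rw [hπ, hπ, h1] at h2
      exact sub_left_injective h2
    · rintro ⟨x, ⟨y, hy⟩⟩
      have hy' : P y = 0 := hy
      change q x = 0 ↔ _
      rw [hex.exact x]
      constructor
      · rintro ⟨y₀, rfl⟩
        refine ⟨j y₀ + y, Prod.ext ?_ (Subtype.ext ?_)⟩
        · simp [hi', hPj, hy']
        · simp [hi', hπ, hPj, hy']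
      · rintro ⟨y₁, hy₁⟩
        exact ⟨P y₁, congrArg Prod.fst hy₁⟩
    · obtain ⟨x, rfl⟩ := hex.surjective z
      exact ⟨(x, 0), rfl⟩
  obtain ⟨Q, hQ⟩ := h (X × W) i' q' hex'
  refine ⟨((ContinuousLinearMap.fst 𝕜 X W).comp ((Submodule.subtypeL _).comp
    (Q.comp (ContinuousLinearMap.inl 𝕜 X W)))).codRestrict _ fun x => ?_, ?_⟩
  · obtain ⟨y, hy⟩ := (Q (x, 0)).2
    exact ⟨P y, congrArg Prod.fst hy⟩
  · rintro ⟨_, ⟨y₀, rfl⟩⟩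
    have hmem : i' (j y₀) = (i y₀, 0) := by
      rw [hi', hPj]
      exact Prod.ext rfl (Subtype.ext (by simp [hπ, hPj]))
    have h1 := congrArg Subtype.val (hQ ⟨_, ⟨j y₀, hmem⟩⟩)
    exact Subtype.ext (congrArg Prod.fst h1)

variable (𝕜 : Type w) [RCLike 𝕜] {S : Type v} [TopologicalSpace S]

/-- A sequence of isolated points of `S` converging to `p` makes `c₀` a retract of `C(S)`: sequences
are extended by zero off the points `d n`, and the retraction is `f ↦ (f (d n) - f p)ₙ`. -/
lemma exists_retraction_zeroAtInfty [CompactSpace S] [T2Space S] {p : S} {d : ℕ → S}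
    (hd : Function.Injective d) (hiso : ∀ n, d n ∉ derivedSet univ)
    (hlim : Tendsto d cofinite (𝓝 p)) :
    ∃ (j : ZeroAtInftyContinuousMap ℕ 𝕜 →L[𝕜] C(S, 𝕜))
      (P : C(S, 𝕜) →L[𝕜] ZeroAtInftyContinuousMap ℕ 𝕜), ∀ a, P (j a) = a := by
  have hopen : ∀ n, IsOpen {d n} := fun n => by
    have := hiso n
    rw [mem_derivedSet, accPt_iff_nhds] at this
    push Not at this
    obtain ⟨U, hU, hUd⟩ := this
    exact isOpen_singleton_iff_nhds_eq_pure _ |>.2 <| le_antisymm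
      (le_pure_iff.2 (mem_of_superset hU fun y hy => hUd y ⟨hy, mem_univ y⟩)) (pure_le_nhds _)
  have hp : ∀ n, d n ≠ p := fun n hn => by
    have h1 := hlim ((hopen n).mem_nhds (show p ∈ {d n} from hn.symm))
    rw [mem_map, mem_cofinite] at h1
    refine infinite_univ (((finite_singleton n).union h1).subset fun m _ => ?_)
    by_cases hm : d m = d n
    · exact Or.inl (hd hm)
    · exact Or.inr hm
  have ha0 : ∀ a : ZeroAtInftyContinuousMap ℕ 𝕜, Tendsto a cofinite (𝓝 0) := fun a => by
    rw [← cocompact_eq_cofinite]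
    exact a.zero_at_infty'
  have hout : ∀ (a : ℕ → 𝕜) (s : S), (∀ n, d n ≠ s) →
      Function.extend d a 0 s = 0 := fun a s hs =>
    Function.extend_apply' _ _ _ fun ⟨n, hn⟩ => hs n hn
  have hcont : ∀ a : ZeroAtInftyContinuousMap ℕ 𝕜, Continuous (Function.extend d a 0) := by
    refine fun a => continuous_iff_continuousAt.2 fun s => ?_
    by_cases hs : ∃ n, d n = s
    · obtain ⟨n, rfl⟩ := hs
      rw [ContinuousAt, (isOpen_singleton_iff_nhds_eq_pure _).1 (hopen n)]
      exact tendsto_pure_nhds _ _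
    · push Not at hs
      rw [ContinuousAt, hout a s hs, Metric.tendsto_nhds]
      intro ε hε
      have hfin : (d '' {n | ¬ dist (a n) 0 < ε}).Finite :=
        Set.Finite.image _ (Metric.tendsto_nhds.1 (ha0 a) ε hε)
      filter_upwards [hfin.isClosed.isOpen_compl.mem_nhds
        (show s ∈ (d '' {n | ¬ dist (a n) 0 < ε})ᶜ from fun ⟨n, _, hn⟩ => hs n hn)] with t ht
      by_cases h : ∃ n, d n = t
      · obtain ⟨n, rfl⟩ := h
        rw [hd.extend_apply]
        by_contra hn
        exact ht ⟨n, hn, rfl⟩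
      · push Not at h
        rwa [hout a t h, dist_self]
  let j : ZeroAtInftyContinuousMap ℕ 𝕜 →ₗ[𝕜] C(S, 𝕜) :=
    { toFun := fun a => ⟨Function.extend d a 0, hcont a⟩
      map_add' := fun a b => ContinuousMap.ext fun s => by
        by_cases h : ∃ n, d n = s
        · obtain ⟨n, rfl⟩ := h
          simp [hd.extend_apply]
        · push Not at h
          simp [hout _ s h]
      map_smul' := fun c a => ContinuousMap.ext fun s => by
        by_cases h : ∃ n, d n = s
        · obtain ⟨n, rfl⟩ := h
          simp [hd.extend_apply]
        · push Not at h
          simp [hout _ s h] }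
  have hj : ∀ a s, j a s = Function.extend d a 0 s := fun a s => rfl
  let P : C(S, 𝕜) →ₗ[𝕜] ZeroAtInftyContinuousMap ℕ 𝕜 :=
    { toFun := fun f => ⟨⟨fun n => f (d n) - f p, continuous_of_discreteTopology⟩, by
        rw [cocompact_eq_cofinite]
        simpa using ((f.continuous.tendsto p).comp hlim).sub_const (f p)⟩
      map_add' := fun f g => ZeroAtInftyContinuousMap.ext fun n =>
        add_sub_add_comm (f (d n)) (g (d n)) (f p) (g p)
      map_smul' := fun c f => ZeroAtInftyContinuousMap.ext fun n =>
        (smul_sub c (f (d n)) (f p)).symm }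
  have hP : ∀ f n, P f n = f (d n) - f p := fun f n => rfl
  refine ⟨j.mkContinuous 1 fun a => ?_, P.mkContinuous 2 fun f => ?_, fun a => ?_⟩
  · rw [one_mul]
    refine (ContinuousMap.norm_le _ (norm_nonneg a)).2 fun s => ?_
    rw [hj]
    by_cases h : ∃ n, d n = s
    · obtain ⟨n, rfl⟩ := h
      rw [hd.extend_apply]
      exact a.toBCF.norm_coe_le_norm n
    · push Not at h
      simp [hout _ s h]
  · refine (BoundedContinuousFunction.norm_le (f := (P f).toBCF) (by positivity)).2 fun n => ?_
    refine (norm_sub_le (f (d n)) (f p)).trans ?_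
    linarith [f.norm_coe_le_norm (d n), f.norm_coe_le_norm p]
  · refine ZeroAtInftyContinuousMap.ext fun n => ?_
    change P (j a) n = a n
    rw [hP, hj, hj, hd.extend_apply, hout a p hp, sub_zero]

end Retract

theorem mainTheorem1 (CH : (Cardinal.aleph 1 : Cardinal.{0}) = Cardinal.continuum.{0})
    (𝕜 : Type w) [RCLike 𝕜]
    (K : Type u) [TopologicalSpace K] [CompactSpace K] [T2Space K]
    (hK : omegaDerivedSet K = ∅) (hKm : ¬ TopologicalSpace.MetrizableSpace K) :
    (∀ (S : Type v) [TopologicalSpace S] [CompactSpace S] [T2Space S] [Infinite S],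
      omegaDerivedSet S = ∅ → ¬ ExtEqZero 𝕜 C(K, 𝕜) C(S, 𝕜)) ∧
    ¬ ExtEqZero 𝕜 C(K, 𝕜) (ZeroAtInftyContinuousMap ℕ 𝕜) := by
  have hc₀ := not_extEqZero_zeroAtInfty CH 𝕜 K hK hKm
  refine ⟨fun S _ _ _ _ hS hExt => hc₀ ?_, hc₀⟩
  obtain ⟨p, d, hd, hiso, hlim⟩ := exists_converging_seq_of_isolated hS
  obtain ⟨j, P, hPj⟩ := exists_retraction_zeroAtInfty 𝕜 hd hiso hlim
  exact hExt.of_retract j P hPj
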